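/- Let $$f(z)=\sum_{j\ge 8}\frac{e^{-j}}{z-\log j}.$$ The series converges absolutely at every $z\in\mathbb C\setminus\{\log j: j\ge 8\}$ and defines a meromorphic function $f:\mathbb C\to\widehat{\mathbb C}$ whose poles are exactly the points $\log j$, $j\ge 8$. A point $b\in\widehat{\mathbb C}$ is called an asymptotic value of $f$ if there is a curve $\gamma:[0,\infty)\to\mathbb C$ with $\gamma(t)\to\infty$ and $f(\gamma(t))\to b$ as $t\to\infty$. The function $f$ has the following properties. 1. $f$ belongs to class $\mathcal B$: the set of its finite critical values (the values $f(c)$ at points $c$ that are not poles and satisfy $f'(c)=0$) and finite asymptotic values is bounded. 2. $f$ has infinite order: $\limsup_{r\to\infty}\frac{\log T(r,f)}{\log r}=\infty$, where $T(r,f)$ is the Nevanlinna characteristic of $f$. 3. $\infty$ is not an asymptotic value of $f$. 4. All poles of $f$ are simple. 5. The escaping set $\mathcal I(f)$ of all $z\in\mathbb C$ for which all iterates $f^n(z)$, $n\ge 0$, are defined and finite and $f^n(z)\to\infty$ as $n\to\infty$ has Hausdorff dimension $0$. -/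

import Mathlib

open Filter Topology

noncomputable section

/-- `z` is a pole of `f`. -/
def IsPole (f : ℂ → ℂ) (z : ℂ) : Prop :=
  meromorphicOrderAt f z < 0

/-- `f : ℂ → ℂ` represents a meromorphic function from the plane to the Riemann sphere:
it is meromorphic at every point and analytic at every point that is not a pole. The number
`f z` at a pole `z` is never used; the true value there is `∞`, see `sphereMap`. -/
def IsMeromorphicFunction (f : ℂ → ℂ) : Prop :=
  (∀ z, MeromorphicAt f z) ∧ ∀ z, ¬ IsPole f z → AnalyticAt ℂ f z

open Classical in
/-- The meromorphic function represented by `f`, as a map into the Riemann sphere. -/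
def sphereMap (f : ℂ → ℂ) (z : ℂ) : OnePoint ℂ :=
  if IsPole f z then OnePoint.infty else ((f z : ℂ) : OnePoint ℂ)

/-- `b` in the Riemann sphere is an asymptotic value of `f`: there is a curve tending to infinity
along which `f` tends to `b`. The curve may run through poles, where `f` is `∞`. -/
def IsAsymptoticValue (f : ℂ → ℂ) (b : OnePoint ℂ) : Prop :=
  ∃ γ : ℝ → ℂ, ContinuousOn γ (Set.Ici 0) ∧
    Tendsto γ atTop (Bornology.cobounded ℂ) ∧
    Tendsto (fun t => sphereMap f (γ t)) atTop (𝓝 b)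

/-- The finite critical values of `f`. -/
def criticalValues (f : ℂ → ℂ) : Set ℂ :=
  {w | ∃ c, ¬ IsPole f c ∧ deriv f c = 0 ∧ f c = w}

/-- The singular set of `f`: all finite critical and finite asymptotic values. -/
def singularSet (f : ℂ → ℂ) : Set ℂ :=
  criticalValues f ∪ {w | IsAsymptoticValue f (w : OnePoint ℂ)}

/-- Class `B` of Eremenko and Lyubich: meromorphic functions with a bounded singular set. -/
def IsClassB (f : ℂ → ℂ) : Prop :=
  IsMeromorphicFunction f ∧ Bornology.IsBounded (singularSet f)

/-- The order of growth `limsup_{r → ∞} log T(r, f) / log r`, where `T(r, f)` is the Nevanlinna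
characteristic of `f`. -/
def growthOrder (f : ℂ → ℂ) : EReal :=
  limsup (fun r : ℝ =>
    ((Real.log (ValueDistribution.characteristic f ⊤ r) / Real.log r : ℝ) : EReal)) atTop

/-- The escaping set: the points whose forward iterates are all defined (the orbit never meets a
pole) and tend to infinity. -/
def escapingSet (f : ℂ → ℂ) : Set ℂ :=
  {z | (∀ n : ℕ, ¬ IsPole f (f^[n] z)) ∧
    Tendsto (fun n : ℕ => f^[n] z) atTop (Bornology.cobounded ℂ)}

/-- The term `e^{-j} / (z - log j)`. -/
def logPoleTerm (j : ℕ) (z : ℂ) : ℂ :=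
  ((Real.exp (-(j : ℝ)) : ℝ) : ℂ) / (z - ((Real.log (j : ℝ) : ℝ) : ℂ))

/-- The series `∑_{j ≥ 8} e^{-j} / (z - log j)`. -/
def logPoleSeries (z : ℂ) : ℂ :=
  ∑' j : {j : ℕ // 8 ≤ j}, logPoleTerm j z

end

/-!
The mechanism is that `f(z) = ∑ e^{-j} / (z - log j)` is large only very close to its poles, and
near each pole it is a Lipschitz perturbation of a single term.

The gaps between consecutive poles are of order `1 / j`, so the discs `poleDisc j` of radius
`1 / (4j)` about the poles are disjoint, and a point outside the `k`-th disc feels the `k`-th term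
with size at most `4k e^{-k}`, which is summable. Hence `f` is bounded by `sumBound` off the discs
(`norm_logPoleSeries_le`), and in `poleDisc j` it equals `e^{-j} / (z - log j)` plus a
`regularPart j` that is bounded by `sumBound` and Lipschitz with constant `lipBound`, uniformly
in `j`.

* At a critical point in `poleDisc j` the derivative of the singular term is balanced by a bounded
  quantity; this keeps the critical point away from the pole and bounds the critical value. A curve
  to infinity along which `f` is large would eventually be trapped in one of the disjoint bounded
  discs (`not_isAsymptoticValue`), so there are no large asymptotic values, and `∞` is none.
* There are about `e^{r/2}` poles in the disc of radius `r / 2`, so the counting function of the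
  poles, and with it the characteristic, grows exponentially
  (`exp_le_characteristic_logPoleSeries`).
* An orbit that stays far from `0` visits only discs with large index `j`, at distance at most
  `e^{-j}` from the pole, and there `f` expands distances by at least `e^j / 2`
  (`le_norm_logPoleSeries_sub`). Pulling covers back multiplies their `s`-dimensional size by at
  most `∑ (2 e^{-j})^s`, which is less than `1` if only large `j` occur. So the set of such points
  has dimension at most `s` (`dimH_le_of_expanding`). The escaping set lies in the union of the
  iterated preimages of this set, and preimages under a locally nonconstant analytic function do
  not increase the dimension (`dimH_le_of_mapsTo`).
-/

/-! ### Subseries and their analyticity -/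

/-- The `j`-th pole `log j`, as a complex number. -/
noncomputable def logPole (j : ℕ) : ℂ := ((Real.log (j : ℝ) : ℝ) : ℂ)

/-- The sum of the terms of `logPoleSeries` with index in `P`. -/
noncomputable def logPoleSum (P : Set ℕ) (z : ℂ) : ℂ := ∑' j : P, logPoleTerm j z

lemma logPoleTerm_eq (j : ℕ) (z : ℂ) :
    logPoleTerm j z = ((Real.exp (-(j : ℝ)) : ℝ) : ℂ) / (z - logPole j) := rfl

lemma norm_logPoleTerm (j : ℕ) (z : ℂ) :
    ‖logPoleTerm j z‖ = Real.exp (-(j : ℝ)) / ‖z - logPole j‖ := by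
  rw [logPoleTerm_eq, norm_div, Complex.norm_of_nonneg (Real.exp_pos _).le]

lemma norm_logPole {j : ℕ} (hj : 1 ≤ j) : ‖logPole j‖ = Real.log j :=
  Complex.norm_of_nonneg (Real.log_nonneg (by exact_mod_cast hj))

lemma norm_logPole_sub (j k : ℕ) : ‖logPole j - logPole k‖ = |Real.log j - Real.log k| := by
  rw [logPole, logPole, ← Complex.ofReal_sub, Complex.norm_real, Real.norm_eq_abs]

lemma tendsto_norm_sub_logPole (z : ℂ) :
    Tendsto (fun j : ℕ => ‖z - logPole j‖) cofinite atTop := by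
  rw [Nat.cofinite_eq_atTop]
  have h : Tendsto (fun j : ℕ => Real.log (j : ℝ) - ‖z‖) atTop atTop :=
    tendsto_atTop_add_const_right _ _ (Real.tendsto_log_atTop.comp tendsto_natCast_atTop_atTop)
  refine tendsto_atTop_mono' _ ?_ h
  filter_upwards [eventually_ge_atTop 1] with j hj
  rw [← norm_logPole hj, norm_sub_rev]
  exact norm_sub_norm_le _ _

lemma summable_exp_neg_nat : Summable fun j : ℕ => Real.exp (-(j : ℝ)) := by
  simpa using Real.summable_pow_mul_exp_neg_nat_mul 0 one_pos

/-- This holds at the poles too, where the division by zero turns one term into `0`. -/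
lemma summable_norm_logPoleTerm (z : ℂ) : Summable fun j : ℕ => ‖logPoleTerm j z‖ := by
  refine summable_exp_neg_nat.of_norm_bounded_eventually ?_
  filter_upwards [(tendsto_norm_sub_logPole z).eventually_ge_atTop 1] with j hj
  rw [norm_norm, norm_logPoleTerm]
  exact div_le_self (Real.exp_pos _).le hj

lemma summable_logPoleTerm (z : ℂ) : Summable fun j : ℕ => logPoleTerm j z :=
  (summable_norm_logPoleTerm z).of_norm

lemma logPoleSum_eq_add {P : Set ℕ} {j : ℕ} (hj : j ∈ P) (z : ℂ) :
    logPoleSum P z = logPoleTerm j z + logPoleSum (P \ {j}) z := by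
  classical
  have hs : Summable (P.indicator fun k => logPoleTerm k z) := (summable_logPoleTerm z).indicator P
  unfold logPoleSum
  rw [tsum_subtype P (fun k => logPoleTerm k z), tsum_subtype (P \ {j}) (fun k => logPoleTerm k z),
    hs.tsum_eq_add_tsum_ite j, Set.indicator_of_mem hj]
  congr 2
  funext k
  by_cases hk : k = j <;> by_cases hP : k ∈ P <;> simp [Set.indicator, hk, hP]

/-- The poles accumulate only at infinity, so a point off the poles with index in `P` keeps a
positive distance from all of them. -/
lemma exists_pos_le_norm_sub_logPole {P : Set ℕ} {z : ℂ} (hz : ∀ k ∈ P, z ≠ logPole k) :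
    ∃ ε > 0, ∀ k ∈ P, ε ≤ ‖z - logPole k‖ := by
  rcases P.eq_empty_or_nonempty with rfl | hP
  · exact ⟨1, one_pos, by simp⟩
  have : Nonempty P := hP.to_subtype
  obtain ⟨k₀, hk₀⟩ := ((tendsto_norm_sub_logPole z).comp
    (Subtype.val_injective (p := (· ∈ P))).tendsto_cofinite).exists_forall_le
  exact ⟨‖z - logPole k₀‖, norm_pos_iff.2 (sub_ne_zero.2 (hz k₀ k₀.2)), fun k hk => hk₀ ⟨k, hk⟩⟩

lemma analyticAt_logPoleSum {P : Set ℕ} {z : ℂ} (hz : ∀ k ∈ P, z ≠ logPole k) :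
    AnalyticAt ℂ (logPoleSum P) z := by
  obtain ⟨ε, hε, h⟩ := exists_pos_le_norm_sub_logPole hz
  have hd : ∀ k ∈ P, ∀ w ∈ Metric.ball z (ε / 2), ε / 2 ≤ ‖w - logPole k‖ := by
    intro k hk w hw
    have h1 := h k hk
    have h2 : ‖z - w‖ < ε / 2 := by rw [← dist_eq_norm, dist_comm]; exact hw
    have h3 := norm_add_le (z - w) (w - logPole k)
    rw [sub_add_sub_cancel] at h3
    linarith
  have hdiff : DifferentiableOn ℂ (logPoleSum P) (Metric.ball z (ε / 2)) := by
    refine Complex.differentiableOn_tsum_of_summable_norm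
      (u := fun k : P => Real.exp (-((k : ℕ) : ℝ)) / (ε / 2))
      ((summable_exp_neg_nat.div_const _).subtype P) ?_ Metric.isOpen_ball ?_
    · intro k w hw
      have hne : w - logPole k ≠ 0 := norm_pos_iff.1 ((half_pos hε).trans_le (hd k k.2 w hw))
      have hsub : DifferentiableAt ℂ (fun w => w - logPole k) w :=
        differentiableAt_fun_id.sub_const _
      exact ((differentiableAt_const _).div hsub hne).differentiableWithinAt
    · intro k w hw
      rw [norm_logPoleTerm]
      exact div_le_div_of_nonneg_left (Real.exp_pos _).le (half_pos hε) (hd k k.2 w hw)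
  exact hdiff.analyticAt (Metric.ball_mem_nhds z (half_pos hε))

/-! ### Uniform bounds away from the poles -/

/-- A common bound for the sums of the terms whose poles `log k` are at distance at least `1 / (4k)`
from the argument. -/
noncomputable def sumBound : ℝ := ∑' k : ℕ, 4 * ((k : ℝ) ^ 1 * Real.exp (-1 * (k : ℝ)))

/-- A common Lipschitz constant for the sums of the terms whose poles `log k` are at distance at
least `1 / (4k)` from the arguments. -/
noncomputable def lipBound : ℝ := ∑' k : ℕ, 16 * ((k : ℝ) ^ 2 * Real.exp (-1 * (k : ℝ)))

lemma summable_sumBound : Summable fun k : ℕ => 4 * ((k : ℝ) ^ 1 * Real.exp (-1 * (k : ℝ))) :=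
  (Real.summable_pow_mul_exp_neg_nat_mul 1 one_pos).mul_left _

lemma summable_lipBound : Summable fun k : ℕ => 16 * ((k : ℝ) ^ 2 * Real.exp (-1 * (k : ℝ))) :=
  (Real.summable_pow_mul_exp_neg_nat_mul 2 one_pos).mul_left _

lemma lipBound_nonneg : 0 ≤ lipBound := tsum_nonneg fun _ => by positivity

lemma norm_logPoleSum_le {P : Set ℕ} (hP : ∀ k ∈ P, 8 ≤ k) {z : ℂ}
    (hz : ∀ k ∈ P, 1 / (4 * (k : ℝ)) ≤ ‖z - logPole k‖) : ‖logPoleSum P z‖ ≤ sumBound := by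
  unfold logPoleSum
  refine (norm_tsum_le_tsum_norm ((summable_norm_logPoleTerm z).subtype P)).trans ?_
  refine Summable.tsum_le_tsum_of_inj (Subtype.val) Subtype.val_injective
    (fun _ _ => by positivity) ?_ ((summable_norm_logPoleTerm z).subtype P) summable_sumBound
  rintro ⟨k, hk⟩
  have h0 : (0 : ℝ) < k := by exact_mod_cast (by have := hP k hk; omega : 0 < k)
  rw [norm_logPoleTerm]
  refine (div_le_div_of_nonneg_left (Real.exp_pos _).le (by positivity) (hz k hk)).trans
    (le_of_eq ?_)
  rw [neg_one_mul]
  field_simp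

lemma norm_logPoleSum_sub_le {P : Set ℕ} (hP : ∀ k ∈ P, 8 ≤ k) {z w : ℂ}
    (hz : ∀ k ∈ P, 1 / (4 * (k : ℝ)) ≤ ‖z - logPole k‖)
    (hw : ∀ k ∈ P, 1 / (4 * (k : ℝ)) ≤ ‖w - logPole k‖) :
    ‖logPoleSum P z - logPoleSum P w‖ ≤ lipBound * ‖z - w‖ := by
  have hterm : ∀ k : P, ‖logPoleTerm k z - logPoleTerm k w‖ ≤
      16 * (((k : ℕ) : ℝ) ^ 2 * Real.exp (-1 * ((k : ℕ) : ℝ))) * ‖z - w‖ := by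
    rintro ⟨k, hk⟩
    have h0 : (0 : ℝ) < k := by exact_mod_cast (by have := hP k hk; omega : 0 < k)
    have hz0 : 0 < 1 / (4 * (k : ℝ)) := by positivity
    have hz1 := hz k hk
    have hw1 := hw k hk
    have hzn : z - logPole k ≠ 0 := norm_pos_iff.1 (hz0.trans_le hz1)
    have hwn : w - logPole k ≠ 0 := norm_pos_iff.1 (hz0.trans_le hw1)
    have e : logPoleTerm k z - logPoleTerm k w =
        ((Real.exp (-(k : ℝ)) : ℝ) : ℂ) * (w - z) / ((z - logPole k) * (w - logPole k)) := by
      rw [logPoleTerm_eq, logPoleTerm_eq]; field_simp; ring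
    simp only
    rw [e, norm_div, norm_mul, norm_mul, Complex.norm_of_nonneg (Real.exp_pos _).le,
      norm_sub_rev w z]
    refine (div_le_div_of_nonneg_left (by positivity) (by positivity)
      (mul_le_mul hz1 hw1 hz0.le (norm_nonneg _))).trans (le_of_eq ?_)
    rw [neg_one_mul]
    field_simp
    ring
  have hs := (summable_logPoleTerm z).subtype P
  have hs' := (summable_logPoleTerm w).subtype P
  have hb := summable_lipBound.mul_right ‖z - w‖
  have hsn : Summable fun k : P => ‖logPoleTerm k z - logPoleTerm k w‖ :=
    Summable.of_nonneg_of_le (fun _ => norm_nonneg _) hterm (hb.subtype P)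
  have e : logPoleSum P z - logPoleSum P w = ∑' k : P, (logPoleTerm k z - logPoleTerm k w) :=
    (hs.tsum_sub hs').symm
  rw [e, lipBound, ← tsum_mul_right]
  refine (norm_tsum_le_tsum_norm hsn).trans ?_
  exact Summable.tsum_le_tsum_of_inj (Subtype.val) Subtype.val_injective
    (fun _ _ => by positivity) hterm hsn hb

/-! ### Disjoint discs about the poles -/

/-- The disc about the pole `log j`. These discs are pairwise disjoint, see
`le_norm_sub_logPole_of_mem_poleDisc`. -/
noncomputable def poleDisc (j : ℕ) : Set ℂ := Metric.ball (logPole j) (1 / (4 * (j : ℝ)))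

lemma mem_poleDisc {j : ℕ} {z : ℂ} : z ∈ poleDisc j ↔ ‖z - logPole j‖ < 1 / (4 * (j : ℝ)) := by
  rw [poleDisc, Metric.mem_ball, dist_eq_norm]

lemma log_gap {j k : ℕ} (hj : 1 ≤ j) (hjk : j < k) :
    1 / (2 * (j : ℝ)) ≤ Real.log k - Real.log j := by
  have h0 : (1 : ℝ) ≤ j := by exact_mod_cast hj
  have h1 : (j : ℝ) + 1 ≤ k := by exact_mod_cast hjk
  have hj0 : (0 : ℝ) < j := by linarith
  have hk0 : (0 : ℝ) < k := by linarith
  rw [← Real.log_div hk0.ne' hj0.ne']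
  have h2 := Real.one_sub_inv_le_log_of_pos (x := (k : ℝ) / j) (by positivity)
  refine le_trans ?_ h2
  rw [inv_div, div_le_iff₀ (by positivity), sub_mul]
  have h3 : (j : ℝ) / k ≤ j / (j + 1) := by gcongr
  have h4 : 2 * (j : ℝ) * (j / (j + 1)) ≤ 2 * j - 1 := by
    rw [mul_div_assoc', div_le_iff₀ (by positivity)]; nlinarith
  nlinarith

lemma le_norm_sub_logPole_of_mem_poleDisc {j k : ℕ} (hj : 8 ≤ j) (hk : 8 ≤ k) (hjk : k ≠ j)
    {z : ℂ} (hz : z ∈ poleDisc j) : 1 / (4 * (k : ℝ)) ≤ ‖z - logPole k‖ := by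
  rw [mem_poleDisc] at hz
  have h3 := norm_add_le (logPole j - z) (z - logPole k)
  rw [sub_add_sub_cancel, norm_logPole_sub, norm_sub_rev _ z] at h3
  have hj0 : (8 : ℝ) ≤ j := by exact_mod_cast hj
  have hk0 : (8 : ℝ) ≤ k := by exact_mod_cast hk
  -- the gap between two poles is at least `1 / (2 min(j, k))`
  have key : ∀ m : ℕ, 8 ≤ m → 1 / (2 * (m : ℝ)) = 1 / (4 * (m : ℝ)) + 1 / (4 * (m : ℝ)) := by
    intro m hm
    have : (0 : ℝ) < m := by exact_mod_cast (by omega : 0 < m)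
    field_simp; norm_num
  rcases lt_or_gt_of_ne hjk with h | h
  · have h1 := log_gap (by omega) h
    have h2 : 1 / (4 * (j : ℝ)) ≤ 1 / (4 * (k : ℝ)) := by gcongr
    rw [key k hk] at h1
    have := le_abs_self (Real.log j - Real.log k)
    linarith
  · have h1 := log_gap (by omega) h
    have h2 : 1 / (4 * (k : ℝ)) ≤ 1 / (4 * (j : ℝ)) := by gcongr
    rw [key j hj] at h1
    have := neg_abs_le (Real.log j - Real.log k)
    linarith

lemma poleDisc_disjoint {j k : ℕ} (hj : 8 ≤ j) (hk : 8 ≤ k) (hjk : k ≠ j) :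
    Disjoint (poleDisc j) (poleDisc k) :=
  Set.disjoint_left.2 fun _ hz hz' =>
    (mem_poleDisc.1 hz').not_ge (le_norm_sub_logPole_of_mem_poleDisc hj hk hjk hz)

/-- The sum of all terms except the `j`-th. -/
noncomputable def regularPart (j : ℕ) : ℂ → ℂ := logPoleSum ({k | 8 ≤ k} \ {j})

lemma logPoleSeries_eq_add {j : ℕ} (hj : 8 ≤ j) (z : ℂ) :
    logPoleSeries z = logPoleTerm j z + regularPart j z :=
  logPoleSum_eq_add (P := {k | 8 ≤ k}) hj z

lemma norm_regularPart_le {j : ℕ} (hj : 8 ≤ j) {z : ℂ} (hz : z ∈ poleDisc j) :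
    ‖regularPart j z‖ ≤ sumBound :=
  norm_logPoleSum_le (fun _ hk => hk.1)
    fun _ hk => le_norm_sub_logPole_of_mem_poleDisc hj hk.1 hk.2 hz

lemma norm_regularPart_sub_le {j : ℕ} (hj : 8 ≤ j) {z w : ℂ} (hz : z ∈ poleDisc j)
    (hw : w ∈ poleDisc j) : ‖regularPart j z - regularPart j w‖ ≤ lipBound * ‖z - w‖ :=
  norm_logPoleSum_sub_le (fun _ hk => hk.1)
    (fun _ hk => le_norm_sub_logPole_of_mem_poleDisc hj hk.1 hk.2 hz)
    fun _ hk => le_norm_sub_logPole_of_mem_poleDisc hj hk.1 hk.2 hw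

lemma norm_logPoleSeries_le {z : ℂ} (hz : ∀ j, 8 ≤ j → z ∉ poleDisc j) :
    ‖logPoleSeries z‖ ≤ sumBound :=
  norm_logPoleSum_le (P := {j | 8 ≤ j}) (fun _ hk => hk)
    fun k hk => not_lt.1 fun h => hz k hk (mem_poleDisc.2 h)

lemma exists_mem_poleDisc {z : ℂ} (hz : sumBound < ‖logPoleSeries z‖) :
    ∃ j, 8 ≤ j ∧ z ∈ poleDisc j := by
  by_contra! h
  exact hz.not_ge (norm_logPoleSeries_le h)

lemma logPole_mem_poleDisc {j : ℕ} (hj : 8 ≤ j) : logPole j ∈ poleDisc j := by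
  have : (0 : ℝ) < j := by exact_mod_cast (by omega : 0 < j)
  exact Metric.mem_ball_self (by positivity)

lemma logPole_ne {j k : ℕ} (hj : 8 ≤ j) (hk : 8 ≤ k) (hjk : k ≠ j) : logPole j ≠ logPole k := by
  intro h
  exact Set.disjoint_left.1 (poleDisc_disjoint hj hk hjk) (logPole_mem_poleDisc hj)
    (h ▸ logPole_mem_poleDisc hk)

lemma analyticAt_regularPart {j : ℕ} (hj : 8 ≤ j) {z : ℂ} (hz : z ∈ poleDisc j) :
    AnalyticAt ℂ (regularPart j) z := by
  refine analyticAt_logPoleSum fun k hk h => ?_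
  exact Set.disjoint_left.1 (poleDisc_disjoint hj hk.1 hk.2) hz (h ▸ logPole_mem_poleDisc hk.1)

/-! ### Meromorphy and the order of the poles -/

lemma analyticAt_logPoleSeries {z : ℂ} (hz : ∀ j, 8 ≤ j → z ≠ logPole j) :
    AnalyticAt ℂ logPoleSeries z :=
  analyticAt_logPoleSum (P := {j | 8 ≤ j}) hz

lemma meromorphicOrderAt_logPoleSeries {j : ℕ} (hj : 8 ≤ j) :
    MeromorphicAt logPoleSeries (logPole j) ∧
      meromorphicOrderAt logPoleSeries (logPole j) = -1 := by
  have hg := analyticAt_regularPart hj (logPole_mem_poleDisc hj)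
  have ht : MeromorphicAt (logPoleTerm j) (logPole j) :=
    (MeromorphicAt.const _ _).div ((MeromorphicAt.id _).sub (MeromorphicAt.const _ _))
  have hm : MeromorphicAt logPoleSeries (logPole j) := by
    have : logPoleSeries = logPoleTerm j + regularPart j := funext (logPoleSeries_eq_add hj)
    rw [this]
    exact ht.add hg.meromorphicAt
  refine ⟨hm, ?_⟩
  refine (meromorphicOrderAt_eq_int_iff (n := -1) hm).2
    ⟨fun z => ((Real.exp (-(j : ℝ)) : ℝ) : ℂ) + (z - logPole j) * regularPart j z, ?_, ?_, ?_⟩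
  · exact analyticAt_const.add ((analyticAt_id.sub analyticAt_const).mul hg)
  · simp
  · filter_upwards [self_mem_nhdsWithin] with z hz
    have : z - logPole j ≠ 0 := sub_ne_zero.2 hz
    rw [logPoleSeries_eq_add hj, logPoleTerm_eq, smul_eq_mul, zpow_neg_one]
    field_simp

lemma isPole_logPoleSeries_iff {z : ℂ} :
    IsPole logPoleSeries z ↔ ∃ j : ℕ, 8 ≤ j ∧ z = logPole j := by
  constructor
  · intro h
    by_contra! h'
    exact absurd h (analyticAt_logPoleSeries h').meromorphicOrderAt_nonneg.not_gt
  · rintro ⟨j, hj, rfl⟩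
    rw [IsPole, (meromorphicOrderAt_logPoleSeries hj).2]
    exact WithTop.coe_lt_coe.2 neg_one_lt_zero

lemma analyticAt_logPoleSeries_of_not_isPole {z : ℂ} (hz : ¬ IsPole logPoleSeries z) :
    AnalyticAt ℂ logPoleSeries z :=
  analyticAt_logPoleSeries fun j hj h => hz (isPole_logPoleSeries_iff.2 ⟨j, hj, h⟩)

lemma isMeromorphicFunction_logPoleSeries : IsMeromorphicFunction logPoleSeries := by
  refine ⟨fun z => ?_, fun z hz => analyticAt_logPoleSeries_of_not_isPole hz⟩
  by_cases hz : IsPole logPoleSeries z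
  · obtain ⟨j, hj, rfl⟩ := isPole_logPoleSeries_iff.1 hz
    exact (meromorphicOrderAt_logPoleSeries hj).1
  · exact (analyticAt_logPoleSeries_of_not_isPole hz).meromorphicAt

/-! ### Critical values -/

lemma norm_logPoleSeries_le_of_mem_poleDisc {j : ℕ} (hj : 8 ≤ j) {z : ℂ} (hz : z ∈ poleDisc j) :
    ‖logPoleSeries z‖ ≤ Real.exp (-(j : ℝ)) / ‖z - logPole j‖ + sumBound := by
  rw [logPoleSeries_eq_add hj, ← norm_logPoleTerm]
  exact (norm_add_le _ _).trans (add_le_add_right (norm_regularPart_le hj hz) _)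

lemma norm_deriv_regularPart_le {j : ℕ} (hj : 8 ≤ j) {z : ℂ} (hz : z ∈ poleDisc j) :
    ‖deriv (regularPart j) z‖ ≤ lipBound := by
  refine norm_deriv_le_of_lip' lipBound_nonneg ?_
  filter_upwards [Metric.isOpen_ball.mem_nhds hz] with w hw
  exact norm_regularPart_sub_le hj hw hz

lemma exp_div_sq_le_of_deriv_eq_zero {j : ℕ} (hj : 8 ≤ j) {c : ℂ} (hc : c ∈ poleDisc j)
    (hne : c ≠ logPole j) (hd : deriv logPoleSeries c = 0) :
    Real.exp (-(j : ℝ)) / ‖c - logPole j‖ ^ 2 ≤ lipBound := by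
  have hne' : c - logPole j ≠ 0 := sub_ne_zero.2 hne
  have h1 : HasDerivAt (logPoleTerm j)
      (-((Real.exp (-(j : ℝ)) : ℝ) : ℂ) / (c - logPole j) ^ 2) c := by
    have h := (hasDerivAt_const c ((Real.exp (-(j : ℝ)) : ℝ) : ℂ)).div
      ((hasDerivAt_id' c).sub_const (logPole j)) hne'
    rw [zero_mul, zero_sub, mul_one] at h
    exact h
  have h2 := (analyticAt_regularPart hj hc).differentiableAt.hasDerivAt
  have h3 : HasDerivAt logPoleSeries _ c :=
    (h1.add h2).congr_of_eventuallyEq (.of_forall (logPoleSeries_eq_add hj))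
  rw [h3.deriv] at hd
  have h4 : ‖-((Real.exp (-(j : ℝ)) : ℝ) : ℂ) / (c - logPole j) ^ 2‖ =
      ‖deriv (regularPart j) c‖ := by
    rw [eq_neg_of_add_eq_zero_left hd, norm_neg]
  rw [norm_div, norm_neg, norm_pow, Complex.norm_of_nonneg (Real.exp_pos _).le] at h4
  exact h4 ▸ norm_deriv_regularPart_le hj hc

/-- At a critical point the singular term `x` of the value satisfies
`x ^ 2 ≤ e^{-j} * lipBound ≤ lipBound`. -/
lemma norm_le_of_mem_criticalValues {w : ℂ} (hw : w ∈ criticalValues logPoleSeries) :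
    ‖w‖ ≤ lipBound + 1 + sumBound := by
  obtain ⟨c, hc, hd, rfl⟩ := hw
  have hl := lipBound_nonneg
  by_cases h : ∃ j, 8 ≤ j ∧ c ∈ poleDisc j
  · obtain ⟨j, hj, hcj⟩ := h
    have hne : c ≠ logPole j := fun h => hc (isPole_logPoleSeries_iff.2 ⟨j, hj, h⟩)
    have h1 := exp_div_sq_le_of_deriv_eq_zero hj hcj hne hd
    have h2 := norm_logPoleSeries_le_of_mem_poleDisc hj hcj
    have hn : 0 < ‖c - logPole j‖ := norm_pos_iff.2 (sub_ne_zero.2 hne)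
    set x := Real.exp (-(j : ℝ)) / ‖c - logPole j‖ with hx
    have he : Real.exp (-(j : ℝ)) ≤ 1 := Real.exp_le_one_iff.2 (by simp)
    have hx2 : x ^ 2 = Real.exp (-(j : ℝ)) * (Real.exp (-(j : ℝ)) / ‖c - logPole j‖ ^ 2) := by
      rw [hx]; field_simp
    have h3 : x ^ 2 ≤ lipBound := by
      rw [hx2]
      exact (mul_le_of_le_one_left (by positivity) he).trans h1
    nlinarith
  · push Not at h
    linarith [norm_logPoleSeries_le h]

/-! ### Asymptotic values -/

/-- A curve to infinity along which `f` is eventually larger than `sumBound` eventually stays in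
the union of the disjoint bounded discs `poleDisc j`, hence in one of them: so there is none. -/
lemma not_isAsymptoticValue {b : OnePoint ℂ}
    (hb : b ∉ OnePoint.some '' Metric.closedBall (0 : ℂ) sumBound) :
    ¬ IsAsymptoticValue logPoleSeries b := by
  rintro ⟨γ, hγ, hinf, hlim⟩
  have hopen : IsOpen (OnePoint.some '' Metric.closedBall (0 : ℂ) sumBound)ᶜ :=
    OnePoint.isOpen_compl_image_coe.2 ⟨Metric.isClosed_closedBall, isCompact_closedBall _ _⟩
  obtain ⟨T, hT⟩ := eventually_atTop.1 (hlim.eventually (hopen.mem_nhds hb))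
  have hdisc : ∀ t, T ≤ t → ∃ j, 8 ≤ j ∧ γ t ∈ poleDisc j := by
    intro t ht
    have h := hT t ht
    by_cases hp : IsPole logPoleSeries (γ t)
    · obtain ⟨j, hj, hz⟩ := isPole_logPoleSeries_iff.1 hp
      exact ⟨j, hj, hz ▸ logPole_mem_poleDisc hj⟩
    · refine exists_mem_poleDisc (not_le.1 fun hle => h ?_)
      rw [sphereMap, if_neg hp]
      exact ⟨_, by simpa using hle, rfl⟩
  set S : ℝ := max T 0
  obtain ⟨j, hj, hSj⟩ := hdisc S (le_max_left _ _)
  have hsub : γ '' Set.Ici S ⊆ poleDisc j := by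
    refine IsPreconnected.subset_left_of_subset_union (v := ⋃ k ∈ {k | 8 ≤ k ∧ k ≠ j}, poleDisc k)
      Metric.isOpen_ball (isOpen_biUnion fun k _ => Metric.isOpen_ball) ?_ ?_ ?_ ?_
    · exact Set.disjoint_iUnion₂_right.2 fun k hk => poleDisc_disjoint hj hk.1 hk.2
    · rintro _ ⟨t, ht, rfl⟩
      obtain ⟨k, hk, hkt⟩ := hdisc t ((le_max_left _ _).trans ht)
      by_cases hkj : k = j
      · exact Or.inl (hkj ▸ hkt)
      · exact Or.inr (Set.mem_biUnion (show k ∈ {k | 8 ≤ k ∧ k ≠ j} from ⟨hk, hkj⟩) hkt)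
    · exact ⟨γ S, ⟨S, Set.self_mem_Ici, rfl⟩, hSj⟩
    · exact isPreconnected_Ici.image _ (hγ.mono (Set.Ici_subset_Ici.2 (le_max_right _ _)))
  have hbdd : Bornology.IsBounded (poleDisc j) := Metric.isBounded_ball
  obtain ⟨t, ht, htS⟩ :=
    ((hinf.eventually (Bornology.isBounded_def.1 hbdd)).and (eventually_ge_atTop S)).exists
  exact ht (hsub ⟨t, htS, rfl⟩)

lemma isClassB_logPoleSeries : IsClassB logPoleSeries := by
  refine ⟨isMeromorphicFunction_logPoleSeries, ?_⟩
  refine (Metric.isBounded_closedBall (x := (0 : ℂ)) (r := lipBound + 1 + sumBound)).subset ?_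
  rintro w (hw | hw)
  · simpa using norm_le_of_mem_criticalValues hw
  · have h : (w : OnePoint ℂ) ∈ OnePoint.some '' Metric.closedBall (0 : ℂ) sumBound := by
      by_contra h
      exact not_isAsymptoticValue h hw
    obtain ⟨v, hv, hvw⟩ := h
    obtain rfl := OnePoint.coe_injective hvw
    have hl := lipBound_nonneg
    simp only [Metric.mem_closedBall, dist_zero_right] at hv ⊢
    linarith

lemma not_isAsymptoticValue_infty : ¬ IsAsymptoticValue logPoleSeries OnePoint.infty :=
  not_isAsymptoticValue (by rintro ⟨v, -, hv⟩; exact OnePoint.coe_ne_infty v hv)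

/-! ### Order of growth -/

open Function.locallyFinsuppWithin in
/-- The poles `log j` with `j ≤ exp (r / 2)` lie in the disc of radius `r / 2`, and each of them
contributes at least `log 2` to the logarithmic counting function at `r`. -/
lemma le_characteristic_logPoleSeries {r : ℝ} (hr : 1 ≤ r) {n : ℕ} (hn : Real.log n ≤ r / 2) :
    ((n : ℝ) - 8) * Real.log 2 ≤ ValueDistribution.characteristic logPoleSeries ⊤ r := by
  classical
  set D := (MeromorphicOn.divisor logPoleSeries Set.univ)⁻ with hD
  set E : Function.locallyFinsupp ℂ ℤ := ∑ j ∈ Finset.Ico 8 n, single (logPole j) 1 with hE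
  have hmer : MeromorphicOn logPoleSeries Set.univ :=
    fun z _ => isMeromorphicFunction_logPoleSeries.1 z
  have hEval : ∀ z, E z = ∑ j ∈ Finset.Ico 8 n, if z = logPole j then (1 : ℤ) else 0 := by
    intro z
    rw [hE, coe_sum, Finset.sum_apply]
    exact Finset.sum_congr rfl fun j _ => single_apply
  have hED : E ≤ D := by
    intro z
    have hnonneg : 0 ≤ D z := (negPart_nonneg (MeromorphicOn.divisor logPoleSeries Set.univ)) z
    rw [hEval]
    by_cases hz : ∃ j ∈ Finset.Ico 8 n, z = logPole j
    · obtain ⟨j, hj, rfl⟩ := hz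
      have hj8 := (Finset.mem_Ico.1 hj).1
      rw [Finset.sum_eq_single_of_mem j hj fun k hk hkj =>
        if_neg (logPole_ne hj8 (Finset.mem_Ico.1 hk).1 hkj), if_pos rfl, hD, negPart_apply,
        MeromorphicOn.divisor_apply hmer (Set.mem_univ _), (meromorphicOrderAt_logPoleSeries hj8).2]
      exact le_of_eq rfl
    · push Not at hz
      rw [Finset.sum_eq_zero fun j hj => if_neg (hz j hj)]
      exact hnonneg
  have h1 : ValueDistribution.logCounting logPoleSeries ⊤ r ≤
      ValueDistribution.characteristic logPoleSeries ⊤ r := by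
    have := ValueDistribution.proximity_nonneg (f := logPoleSeries) (a := ⊤) r
    simpa [ValueDistribution.characteristic] using this
  have h2 : logCounting E r ≤ ValueDistribution.logCounting logPoleSeries ⊤ r := by
    rw [ValueDistribution.logCounting_top]
    exact logCounting_le hED hr
  have hr2 : Real.log r - Real.log (r / 2) = Real.log 2 := by
    rw [Real.log_div (by positivity) two_ne_zero]; ring
  have hpole : ∀ j ∈ Finset.Ico 8 n, 0 < ‖logPole j‖ ∧ ‖logPole j‖ ≤ r / 2 := by
    intro j hj
    obtain ⟨hj8, hjn⟩ := Finset.mem_Ico.1 hj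
    have h8 : (8 : ℝ) ≤ j := by exact_mod_cast hj8
    have hjn' : (j : ℝ) ≤ n := by exact_mod_cast hjn.le
    rw [norm_logPole (by omega)]
    exact ⟨Real.log_pos (by linarith), (Real.log_le_log (by linarith) hjn').trans hn⟩
  have h3 : logCounting E r = ∑ j ∈ Finset.Ico 8 n, (Real.log r - Real.log ‖logPole j‖) := by
    rw [hE, map_sum, Finset.sum_apply]
    refine Finset.sum_congr rfl fun j hj => ?_
    rw [logCounting_single_eq_log_sub_const (by linarith [hpole j hj]), Int.cast_one, one_mul]
  refine le_trans ?_ (h2.trans h1)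
  rw [h3]
  calc ((n : ℝ) - 8) * Real.log 2 ≤ ((n - 8 : ℕ) : ℝ) * Real.log 2 := by
        gcongr
        have : (n : ℝ) ≤ ((n - 8 : ℕ) : ℝ) + 8 := by exact_mod_cast (by omega : n ≤ n - 8 + 8)
        linarith
    _ = ∑ j ∈ Finset.Ico 8 n, Real.log 2 := by simp
    _ ≤ _ := by
        refine Finset.sum_le_sum fun j hj => ?_
        rw [← hr2]
        have := Real.log_le_log (hpole j hj).1 (hpole j hj).2
        linarith

lemma exp_le_characteristic_logPoleSeries {r : ℝ} (hr : 40 ≤ r) :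
    Real.exp (r / 4) ≤ ValueDistribution.characteristic logPoleSeries ⊤ r := by
  have hfloor : Real.log (⌊Real.exp (r / 2)⌋₊ : ℝ) ≤ r / 2 := by
    rw [← Real.log_exp (r / 2)]
    refine Real.log_le_log ?_ ?_
    · rw [Real.log_exp]
      exact_mod_cast Nat.floor_pos.2 (Real.one_le_exp (by linarith))
    · rw [Real.log_exp]
      exact Nat.floor_le (Real.exp_pos _).le
  have h1 := le_characteristic_logPoleSeries (by linarith) hfloor
  have h2 := Nat.lt_floor_add_one (Real.exp (r / 2))
  have h3 : Real.exp (r / 2) = Real.exp (r / 4) * Real.exp (r / 4) := by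
    rw [← Real.exp_add]; ring_nf
  have h4 := Real.add_one_le_exp (r / 4)
  have h5 : 1 / 2 * (⌊Real.exp (r / 2)⌋₊ - 8 : ℝ) ≤ (⌊Real.exp (r / 2)⌋₊ - 8 : ℝ) * Real.log 2 := by
    rw [mul_comm]
    exact mul_le_mul_of_nonneg_left (by linarith [Real.log_two_gt_d9]) (by nlinarith)
  nlinarith

lemma growthOrder_logPoleSeries : growthOrder logPoleSeries = ⊤ := by
  refine Tendsto.limsup_eq (EReal.tendsto_coe_nhds_top_iff.2 ?_)
  have h1 : Tendsto (fun r : ℝ => Real.log r / r) atTop (𝓝[>] 0) := by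
    refine tendsto_nhdsWithin_iff.2 ⟨Real.isLittleO_log_id_atTop.tendsto_div_nhds_zero, ?_⟩
    filter_upwards [eventually_gt_atTop 1] with r hr
    exact div_pos (Real.log_pos hr) (by linarith)
  have h2 := (h1.inv_tendsto_nhdsGT_zero).const_mul_atTop (show (0 : ℝ) < 1 / 4 by norm_num)
  refine tendsto_atTop_mono' _ ?_ h2
  filter_upwards [eventually_ge_atTop 40] with r hr
  have hlog : 0 < Real.log r := Real.log_pos (by linarith)
  have h3 := Real.log_le_log (Real.exp_pos _) (exp_le_characteristic_logPoleSeries hr)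
  rw [Real.log_exp] at h3
  rw [Pi.inv_apply, inv_div, le_div_iff₀ hlog]
  refine le_trans (le_of_eq ?_) h3
  field_simp

/-! ### Hausdorff dimension of invariant sets of expanding maps -/

open MeasureTheory in
/-- The diameters of the covering sets need not be assumed to be small: each of them is at most
the `s`-th root of the sum. -/
lemma hausdorffMeasure_eq_zero_of_forall_exists_cover {X : Type*} [EMetricSpace X]
    [MeasurableSpace X] [BorelSpace X] {A : Set X} {s : ℝ} (hs : 0 < s) {ε : ℕ → ENNReal}
    (hε : Tendsto ε atTop (𝓝 0))
    (h : ∀ n, ∃ t : ℕ → Set X, A ⊆ ⋃ i, t i ∧ ∑' i, Metric.ediam (t i) ^ s ≤ ε n) :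
    Measure.hausdorffMeasure s A = 0 := by
  choose t ht hsum using h
  have hr : Tendsto (fun n => ε n ^ s⁻¹) atTop (𝓝 0) := by
    have := (ENNReal.continuous_rpow_const (y := s⁻¹)).tendsto 0 |>.comp hε
    rwa [ENNReal.zero_rpow_of_pos (inv_pos.2 hs)] at this
  have key := Measure.hausdorffMeasure_le_liminf_tsum s A (fun n => ε n ^ s⁻¹) hr t
    (.of_forall fun n i => ?_) (.of_forall ht)
  · refine le_antisymm (key.trans ?_) zero_le
    exact (liminf_le_liminf (.of_forall hsum)).trans_eq hε.liminf_eq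
  · rw [ENNReal.le_rpow_inv_iff hs]
    exact (ENNReal.le_tsum i).trans (hsum n)

/-- If a self-map of `A` expands distances on the pieces of a countable cover of `A`, by at
least the factor `(c j)⁻¹` on the `j`-th piece, and the piece has diameter at most `c j`, then
`∑ c j ^ s < 1` forces `A` to have dimension at most `s`: pulling back a cover of `A` along the
pieces multiplies its `s`-dimensional size by at most `∑ c j ^ s`. -/
lemma dimH_le_of_expanding {X : Type*} [EMetricSpace X] {A : Set X} {f : X → X}
    (hf : Set.MapsTo f A A) {D : ℕ → Set X} (hD : A ⊆ ⋃ j, D j) {c : ℕ → ENNReal}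
    (hexp : ∀ j, ∀ z ∈ A ∩ D j, ∀ w ∈ A ∩ D j, edist z w ≤ c j * edist (f z) (f w))
    (hdiam : ∀ j, Metric.ediam (A ∩ D j) ≤ c j) {s : NNReal} (hs : 0 < s)
    (hc : ∑' j, c j ^ (s : ℝ) < 1) : dimH A ≤ s := by
  borelize X
  have hs' : (0 : ℝ) < s := hs
  set q := ∑' j, c j ^ (s : ℝ) with hq
  have hcover : ∀ n, ∃ t : ℕ → Set X, A ⊆ ⋃ i, t i ∧
      ∑' i, Metric.ediam (t i) ^ (s : ℝ) ≤ q ^ (n + 1) := by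
    intro n
    induction n with
    | zero =>
      refine ⟨fun j => A ∩ D j, fun z hz => ?_, ?_⟩
      · obtain ⟨j, hj⟩ := Set.mem_iUnion.1 (hD hz)
        exact Set.mem_iUnion.2 ⟨j, hz, hj⟩
      · rw [zero_add, pow_one]
        exact ENNReal.tsum_le_tsum fun j => ENNReal.rpow_le_rpow (hdiam j) hs'.le
    | succ n ih =>
      obtain ⟨t, htA, ht⟩ := ih
      -- the pieces of the cover `t` pulled back along the pieces `D j`
      let u : ℕ × ℕ → Set X := fun p => (A ∩ D p.1) ∩ f ⁻¹' t p.2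
      have hu : ∀ p, Metric.ediam (u p) ≤ c p.1 * Metric.ediam (t p.2) := by
        refine fun p => Metric.ediam_le fun z hz w hw => ?_
        exact (hexp p.1 z hz.1 w hw.1).trans (by
          gcongr; exact Metric.edist_le_ediam_of_mem hz.2 hw.2)
      refine ⟨fun i => u (Nat.pairEquiv.symm i), fun z hz => ?_, ?_⟩
      · obtain ⟨j, hj⟩ := Set.mem_iUnion.1 (hD hz)
        obtain ⟨i, hi⟩ := Set.mem_iUnion.1 (htA (hf hz))
        refine Set.mem_iUnion.2 ⟨Nat.pairEquiv (j, i), ?_⟩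
        rw [Equiv.symm_apply_apply]
        exact ⟨⟨hz, hj⟩, hi⟩
      · calc ∑' i, Metric.ediam (u (Nat.pairEquiv.symm i)) ^ (s : ℝ)
            = ∑' p, Metric.ediam (u p) ^ (s : ℝ) :=
              Nat.pairEquiv.symm.tsum_eq fun p => Metric.ediam (u p) ^ (s : ℝ)
          _ ≤ ∑' p : ℕ × ℕ, c p.1 ^ (s : ℝ) * Metric.ediam (t p.2) ^ (s : ℝ) := by
              refine ENNReal.tsum_le_tsum fun p => ?_
              rw [← ENNReal.mul_rpow_of_nonneg _ _ hs'.le]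
              exact ENNReal.rpow_le_rpow (hu p) hs'.le
          _ = q * ∑' i, Metric.ediam (t i) ^ (s : ℝ) := by
              rw [ENNReal.tsum_prod (f := fun j i => c j ^ (s : ℝ) * Metric.ediam (t i) ^ (s : ℝ)),
                hq, ← ENNReal.tsum_mul_right]
              exact tsum_congr fun j => ENNReal.tsum_mul_left
          _ ≤ q * q ^ (n + 1) := by gcongr
          _ = q ^ (n + 1 + 1) := (pow_succ' q (n + 1)).symm
  have hzero := hausdorffMeasure_eq_zero_of_forall_exists_cover hs'
    ((ENNReal.tendsto_pow_atTop_nhds_zero_of_lt_one hc).comp (tendsto_add_atTop_nat 1)) hcover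
  exact dimH_le_of_hausdorffMeasure_ne_top (by rw [hzero]; exact ENNReal.zero_ne_top)

/-! ### Hausdorff dimension of preimages -/

lemma dimH_le_of_mapsTo_of_deriv_ne_zero {f : ℂ → ℂ} {S B : Set ℂ} (hf : ∀ z ∈ S, AnalyticAt ℂ f z)
    (hd : ∀ z ∈ S, deriv f z ≠ 0) (hSB : Set.MapsTo f S B) : dimH S ≤ dimH B := by
  by_contra! hlt
  obtain ⟨x, hx, h⟩ := exists_mem_nhdsWithin_lt_dimH_of_lt_dimH hlt
  obtain ⟨U, hxU, hU, happ⟩ :=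
    ((hf x hx).hasStrictDerivAt.hasStrictFDerivAt_equiv (hd x hx)).approximates_deriv_on_open_nhds
  have hanti := happ.antilipschitz (
    (ContinuousLinearEquiv.subsingleton_or_nnnorm_symm_pos _).imp_right
    fun hpos => NNReal.half_lt_self (inv_pos.2 hpos).ne')
  refine (h (S ∩ U) (inter_mem_nhdsWithin S (hU.mem_nhds hxU))).not_ge ?_
  have hsub : S ∩ U ⊆ Subtype.val '' ((U.domRestrict f) ⁻¹' B) :=
    fun z hz => ⟨⟨z, hz.2⟩, hSB hz.1, rfl⟩
  calc dimH (S ∩ U) ≤ dimH (Subtype.val '' ((U.domRestrict f) ⁻¹' B)) := dimH_mono hsub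
    _ = dimH ((U.domRestrict f) ⁻¹' B) := isometry_subtype_coe.dimH_image _
    _ ≤ dimH B := hanti.dimH_preimage_le B

/-- A locally nonconstant analytic function does not lower the dimension of a set: off its critical
points, which are isolated, it is locally bi-Lipschitz. -/
lemma dimH_le_of_mapsTo {f : ℂ → ℂ} {S B : Set ℂ} (hf : ∀ z ∈ S, AnalyticAt ℂ f z)
    (hd : ∀ z ∈ S, ¬ ∀ᶠ w in 𝓝 z, deriv f w = 0) (hSB : Set.MapsTo f S B) :
    dimH S ≤ dimH B := by
  have hreg : dimH {z ∈ S | deriv f z ≠ 0} ≤ dimH B :=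
    dimH_le_of_mapsTo_of_deriv_ne_zero (fun z hz => hf z hz.1) (fun z hz => hz.2)
      fun z hz => hSB hz.1
  by_contra! hlt
  obtain ⟨x, hx, h⟩ := exists_mem_nhdsWithin_lt_dimH_of_lt_dimH hlt
  have hne := (hf x hx).deriv.eventually_eq_zero_or_eventually_ne_zero.resolve_left (hd x hx)
  have ht : {x} ∪ {z ∈ S | deriv f z ≠ 0} ∈ 𝓝[S] x := by
    filter_upwards [nhdsWithin_le_nhds (eventually_nhdsWithin_iff.1 hne), self_mem_nhdsWithin]
      with z hz hzS
    by_cases hzx : z = x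
    · exact Or.inl hzx
    · exact Or.inr ⟨hzS, hz hzx⟩
  refine (h _ ht).not_ge ?_
  rw [dimH_union, dimH_singleton]
  exact max_le zero_le hreg

/-! ### The escaping set -/

/-- By the identity theorem it is enough to look at a pole, near which the derivative is
unbounded. -/
lemma not_eventually_deriv_logPoleSeries_eq_zero (z : ℂ) :
    ¬ ∀ᶠ w in 𝓝 z, deriv logPoleSeries w = 0 := by
  intro h
  have hmer : MeromorphicOn (deriv logPoleSeries) Set.univ :=
    fun w _ => (isMeromorphicFunction_logPoleSeries.1 w).deriv
  have htop : meromorphicOrderAt (deriv logPoleSeries) z = ⊤ :=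
    meromorphicOrderAt_eq_top_iff.2 (h.filter_mono nhdsWithin_le_nhds)
  have hpole : meromorphicOrderAt (deriv logPoleSeries) (logPole 8) = ⊤ := by
    by_contra hne
    exact (hmer.exists_meromorphicOrderAt_ne_top_iff_forall isConnected_univ).1
      ⟨⟨logPole 8, Set.mem_univ _⟩, hne⟩ ⟨z, Set.mem_univ _⟩ htop
  have h8 : (8 : ℕ) ≤ 8 := le_rfl
  have hcont : ∀ᶠ w in 𝓝 (logPole 8), (lipBound + 1) * ‖w - logPole 8‖ ^ 2 <
      Real.exp (-((8 : ℕ) : ℝ)) := by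
    have hc : ContinuousAt (fun w => (lipBound + 1) * ‖w - logPole 8‖ ^ 2) (logPole 8) := by
      fun_prop
    refine hc.eventually (gt_mem_nhds ?_)
    simpa using Real.exp_pos _
  obtain ⟨w, ⟨⟨hw1, hw2⟩, hw3⟩, hw4⟩ := ((((meromorphicOrderAt_eq_top_iff.1 hpole).and
    (nhdsWithin_le_nhds hcont)).and (nhdsWithin_le_nhds
      (Metric.isOpen_ball.mem_nhds (logPole_mem_poleDisc h8)))).and self_mem_nhdsWithin).exists
  have h1 := exp_div_sq_le_of_deriv_eq_zero h8 hw3 hw4 hw1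
  have hpos : 0 < ‖w - logPole 8‖ ^ 2 := pow_pos (norm_pos_iff.2 (sub_ne_zero.2 hw4)) 2
  rw [div_le_iff₀ hpos] at h1
  linarith

/-- Near the pole `log j` the function is expanding, because its singular part is and its regular
part is Lipschitz. -/
lemma le_norm_logPoleSeries_sub {j : ℕ} (hj : 8 ≤ j) {z w : ℂ} (hz : z ∈ poleDisc j)
    (hw : w ∈ poleDisc j) (hz0 : z ≠ logPole j) (hw0 : w ≠ logPole j)
    (hz1 : ‖z - logPole j‖ ≤ Real.exp (-(j : ℝ))) (hw1 : ‖w - logPole j‖ ≤ Real.exp (-(j : ℝ))) :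
    (Real.exp j - lipBound) * ‖z - w‖ ≤ ‖logPoleSeries z - logPoleSeries w‖ := by
  have hzn : z - logPole j ≠ 0 := sub_ne_zero.2 hz0
  have hwn : w - logPole j ≠ 0 := sub_ne_zero.2 hw0
  have e : logPoleTerm j z - logPoleTerm j w =
      ((Real.exp (-(j : ℝ)) : ℝ) : ℂ) * (w - z) / ((z - logPole j) * (w - logPole j)) := by
    rw [logPoleTerm_eq, logPoleTerm_eq]; field_simp; ring
  have h1 : Real.exp j * ‖z - w‖ ≤ ‖logPoleTerm j z - logPoleTerm j w‖ := by
    rw [e, norm_div, norm_mul, norm_mul, Complex.norm_of_nonneg (Real.exp_pos _).le,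
      norm_sub_rev w z, le_div_iff₀ (mul_pos (norm_pos_iff.2 hzn) (norm_pos_iff.2 hwn))]
    calc Real.exp j * ‖z - w‖ * (‖z - logPole j‖ * ‖w - logPole j‖)
        ≤ Real.exp j * ‖z - w‖ * (Real.exp (-(j : ℝ)) * Real.exp (-(j : ℝ))) := by gcongr
      _ = (Real.exp j * Real.exp (-(j : ℝ))) * (Real.exp (-(j : ℝ)) * ‖z - w‖) := by ring
      _ = Real.exp (-(j : ℝ)) * ‖z - w‖ := by rw [← Real.exp_add, add_neg_cancel, Real.exp_zero,
          one_mul]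
  have h2 := norm_regularPart_sub_le hj hz hw
  have h3 : logPoleTerm j z - logPoleTerm j w =
      (logPoleSeries z - logPoleSeries w) - (regularPart j z - regularPart j w) := by
    rw [logPoleSeries_eq_add hj z, logPoleSeries_eq_add hj w]; ring
  have h4 := norm_sub_le (logPoleSeries z - logPoleSeries w) (regularPart j z - regularPart j w)
  rw [← h3] at h4
  linarith

/-- The points whose orbits avoid the poles and stay outside the disc of radius `R`. -/
def farOrbitSet (R : ℝ) : Set ℂ :=
  {z | ∀ n : ℕ, ¬ IsPole logPoleSeries (logPoleSeries^[n] z) ∧ R < ‖logPoleSeries^[n] z‖}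

lemma mapsTo_farOrbitSet (R : ℝ) : Set.MapsTo logPoleSeries (farOrbitSet R) (farOrbitSet R) := by
  intro z hz n
  have := hz (n + 1)
  rwa [Function.iterate_succ_apply] at this

lemma exists_mem_poleDisc_of_mem_farOrbitSet {R : ℝ} {J : ℕ} (hJ : 8 ≤ J)
    (hR : sumBound ≤ R) (hRJ : Real.log J + 1 ≤ R) {z : ℂ} (hz : z ∈ farOrbitSet R) :
    ∃ j, z ∈ poleDisc (j + J) := by
  obtain ⟨j, hj, hzj⟩ := exists_mem_poleDisc (hR.trans_lt (hz 1).2)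
  have h8 : (8 : ℝ) ≤ j := by exact_mod_cast hj
  have hJ8 : (8 : ℝ) ≤ J := by exact_mod_cast hJ
  have h0 : R < ‖z‖ := (hz 0).2
  have h1 := mem_poleDisc.1 hzj
  have h2 : 1 / (4 * (j : ℝ)) ≤ 1 := by rw [div_le_one (by linarith)]; linarith
  have h3 := norm_le_norm_add_norm_sub' z (logPole j)
  rw [norm_logPole (by omega)] at h3
  have h4 : Real.log J < Real.log j := by linarith
  have h5 : J < j := by exact_mod_cast (Real.log_lt_log_iff (by linarith) (by linarith)).1 h4
  refine ⟨j - J, ?_⟩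
  rwa [Nat.sub_add_cancel h5.le]

lemma norm_sub_logPole_le_of_mem_farOrbitSet {R : ℝ} {j : ℕ} (hj : 8 ≤ j)
    (hR : sumBound + 1 ≤ R) {z : ℂ} (hz : z ∈ farOrbitSet R) (hzj : z ∈ poleDisc j) :
    z ≠ logPole j ∧ ‖z - logPole j‖ ≤ Real.exp (-(j : ℝ)) := by
  have hne : z ≠ logPole j := fun h => (hz 0).1 (isPole_logPoleSeries_iff.2 ⟨j, hj, h⟩)
  refine ⟨hne, ?_⟩
  have h1 := norm_logPoleSeries_le_of_mem_poleDisc hj hzj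
  have h2 : R < ‖logPoleSeries z‖ := (hz 1).2
  have h3 : 1 ≤ Real.exp (-(j : ℝ)) / ‖z - logPole j‖ := by linarith
  rwa [one_le_div (norm_pos_iff.2 (sub_ne_zero.2 hne))] at h3

lemma tsum_two_mul_exp_rpow_ne_top {s : ℝ} (hs : 0 < s) :
    ∑' j : ℕ, ENNReal.ofReal (2 * Real.exp (-(j : ℝ))) ^ s ≠ ⊤ := by
  have h : Summable fun j : ℕ => 2 ^ s * ((j : ℝ) ^ 0 * Real.exp (-s * j)) :=
    (Real.summable_pow_mul_exp_neg_nat_mul 0 hs).mul_left _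
  refine ne_of_eq_of_ne (tsum_congr fun j => ?_) h.tsum_ofReal_ne_top
  rw [ENNReal.ofReal_rpow_of_pos (by positivity), Real.mul_rpow two_pos.le (Real.exp_pos _).le,
    ← Real.exp_mul, pow_zero, one_mul]
  ring_nf

lemma exists_dimH_farOrbitSet_le {s : NNReal} (hs : 0 < s) : ∃ R, dimH (farOrbitSet R) ≤ s := by
  have htail := ENNReal.tendsto_sum_nat_add _ (tsum_two_mul_exp_rpow_ne_top (s := s) hs)
  have hexp : Tendsto (fun j : ℕ => Real.exp (j : ℝ)) atTop atTop :=
    Real.tendsto_exp_atTop.comp tendsto_natCast_atTop_atTop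
  -- `J` makes the tail sum small and `exp j - lipBound ≥ exp j / 2` for `j ≥ J`; orbits outside the
  -- disc of radius `log J + 1` visit only discs with index at least `J`
  obtain ⟨J, ⟨hJ1, hJ2⟩, hJ8⟩ := (((htail.eventually (gt_mem_nhds one_pos)).and
    (hexp.eventually_ge_atTop (2 * lipBound))).and (eventually_ge_atTop 8)).exists
  refine ⟨max (sumBound + 1) (Real.log J + 1), ?_⟩
  set R := max (sumBound + 1) (Real.log J + 1)
  have hR1 : sumBound + 1 ≤ R := le_max_left _ _
  have hnear := fun j (z : ℂ) =>
    norm_sub_logPole_le_of_mem_farOrbitSet (j := j + J) (z := z) (by omega) hR1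
  refine dimH_le_of_expanding (mapsTo_farOrbitSet R) (D := fun j => poleDisc (j + J))
    (fun z hz => Set.mem_iUnion.2 (exists_mem_poleDisc_of_mem_farOrbitSet hJ8 (by linarith)
      (le_max_right _ _) hz)) (c := fun j => ENNReal.ofReal (2 * Real.exp (-((j + J : ℕ) : ℝ))))
    ?_ ?_ hs hJ1
  · rintro j z ⟨hz, hzj⟩ w ⟨hw, hwj⟩
    have h1 := le_norm_logPoleSeries_sub (j := j + J) (by omega) hzj hwj (hnear j z hz hzj).1
      (hnear j w hw hwj).1 (hnear j z hz hzj).2 (hnear j w hw hwj).2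
    have h2 : Real.exp J ≤ Real.exp ((j + J : ℕ) : ℝ) :=
      Real.exp_le_exp.2 (by exact_mod_cast Nat.le_add_left J j)
    have h3 : Real.exp ((j + J : ℕ) : ℝ) / 2 * ‖z - w‖ ≤
        ‖logPoleSeries z - logPoleSeries w‖ := by
      refine le_trans ?_ h1
      gcongr
      linarith
    rw [edist_dist, edist_dist, ← ENNReal.ofReal_mul (by positivity), dist_eq_norm, dist_eq_norm]
    refine ENNReal.ofReal_le_ofReal ?_
    calc ‖z - w‖ = 2 * Real.exp (-((j + J : ℕ) : ℝ)) *
          (Real.exp ((j + J : ℕ) : ℝ) / 2 * ‖z - w‖) := by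
            rw [Real.exp_neg]; field_simp
      _ ≤ _ := by gcongr
  · intro j
    refine Metric.ediam_le fun z hz w hw => ?_
    rw [edist_dist]
    refine ENNReal.ofReal_le_ofReal ?_
    have h1 := dist_triangle_right z w (logPole (j + J))
    rw [dist_eq_norm z (logPole _), dist_eq_norm w (logPole _)] at h1
    linarith [(hnear j z hz.1 hz.2).2, (hnear j w hw.1 hw.2).2]

/-- The points whose orbits avoid the poles and enter `farOrbitSet R` at the `N`-th step. -/
def eventuallyFarOrbitSet (R : ℝ) (N : ℕ) : Set ℂ :=
  {z | (∀ n : ℕ, ¬ IsPole logPoleSeries (logPoleSeries^[n] z)) ∧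
    logPoleSeries^[N] z ∈ farOrbitSet R}

lemma dimH_eventuallyFarOrbitSet_le (R : ℝ) (N : ℕ) :
    dimH (eventuallyFarOrbitSet R N) ≤ dimH (farOrbitSet R) := by
  induction N with
  | zero => exact dimH_mono fun z hz => hz.2
  | succ N ih =>
    refine le_trans (dimH_le_of_mapsTo (f := logPoleSeries) ?_ ?_ ?_) ih
    · exact fun z hz => analyticAt_logPoleSeries_of_not_isPole (hz.1 0)
    · exact fun z _ => not_eventually_deriv_logPoleSeries_eq_zero z
    · refine fun z hz => ⟨fun n => ?_, ?_⟩
      · have := hz.1 (n + 1)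
        rwa [Function.iterate_succ_apply] at this
      · have := hz.2
        rwa [Function.iterate_succ_apply] at this

lemma escapingSet_subset (R : ℝ) :
    escapingSet logPoleSeries ⊆ ⋃ N, eventuallyFarOrbitSet R N := by
  rintro z ⟨hz, hlim⟩
  obtain ⟨N, hN⟩ := eventually_atTop.1
    ((tendsto_norm_cobounded_atTop.comp hlim).eventually_gt_atTop R)
  refine Set.mem_iUnion.2 ⟨N, hz, fun n => ?_⟩
  rw [← Function.iterate_add_apply]
  exact ⟨hz _, hN _ (Nat.le_add_left N n)⟩

lemma dimH_escapingSet_logPoleSeries : dimH (escapingSet logPoleSeries) = 0 := by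
  by_contra h
  obtain ⟨s, hs0, hs⟩ := ENNReal.lt_iff_exists_nnreal_btwn.1 (pos_iff_ne_zero.2 h)
  obtain ⟨R, hR⟩ := exists_dimH_farOrbitSet_le (s := s) (by exact_mod_cast hs0)
  refine hs.not_ge ((dimH_mono (escapingSet_subset R)).trans ?_)
  rw [dimH_iUnion]
  exact iSup_le fun N => (dimH_eventuallyFarOrbitSet_le R N).trans hR

theorem theorem7p2 :
    -- the series converges absolutely off the points `log j`, and these are exactly the poles
    (∀ z : ℂ, (∀ j : ℕ, 8 ≤ j → z ≠ ((Real.log (j : ℝ) : ℝ) : ℂ)) →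
      Summable (fun j : {j : ℕ // 8 ≤ j} => logPoleTerm j z)) ∧
    (∀ z : ℂ, IsPole logPoleSeries z ↔
      ∃ j : ℕ, 8 ≤ j ∧ z = ((Real.log (j : ℝ) : ℝ) : ℂ)) ∧
    IsMeromorphicFunction logPoleSeries ∧
    IsClassB logPoleSeries ∧
    growthOrder logPoleSeries = ⊤ ∧
    ¬ IsAsymptoticValue logPoleSeries OnePoint.infty ∧
    (∀ z : ℂ, IsPole logPoleSeries z → meromorphicOrderAt logPoleSeries z = -1) ∧
    dimH (escapingSet logPoleSeries) = 0 := by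
  refine ⟨fun z _ => (summable_logPoleTerm z).subtype {j | 8 ≤ j},
    fun z => isPole_logPoleSeries_iff, isMeromorphicFunction_logPoleSeries, isClassB_logPoleSeries,
    growthOrder_logPoleSeries, not_isAsymptoticValue_infty, fun z hz => ?_,
    dimH_escapingSet_logPoleSeries⟩
  obtain ⟨j, hj, rfl⟩ := isPole_logPoleSeries_iff.1 hz
  exact (meromorphicOrderAt_logPoleSeries hj).2
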